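/- There are $n$ boxes with rewards $X_1,\dots,X_n$ drawn i.i.d. from a distribution $\mathcal D$ on $[0,\infty)$ with CDF $F$ and density $f$. For known noise levels $0\le\sigma_1\le\dots\le\sigma_n$ one observes $Y_i=X_i+\varepsilon_i$, where $\varepsilon_i\sim\mathcal N(0,\sigma_i^2)$ (so $\varepsilon_i=0$ if $\sigma_i=0$), and $X_1,\dots,X_n,\varepsilon_1,\dots,\varepsilon_n$ are independent. The distribution $\mathcal D$ is MHR (has monotone hazard rate) if $\frac{1-F(x)}{f(x)}$ is non-increasing (with value $+\infty$ where $f(x)=0<1-F(x)$, and value $0$ where $F(x)=1$). Write $\mathbb E[\mathcal D_{m:m}]$ for the expected maximum of $m$ i.i.d. draws from $\mathcal D$. The policy $\mathsf{IgnoreLargeExp}$ draws $\alpha$ uniformly from $[0,1]$, independently of everything else, and picks the box $i$ with the largest observation $Y_i$ among the boxes $1\le i\le n^\alpha$; its expected reward $R_{\mathsf{IgnoreLargeExp}}(\mathcal D,\boldsymbol\sigma)$ is the expectation of $X_i$ for the picked box $i$. **Theorem.** Let $c\in(0,1]$, let $\mathcal D$ be an MHR distribution, let $n\ge e^{4/(c\pi)}$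 be an integer, and let $k$ be either $\lfloor n^c\rfloor$ or $\lceil n^c\rceil$. Then for all $0\le\sigma_1\le\dots\le\sigma_n$ with $$\sigma_k\le\frac{\mathbb E[\mathcal D_{k:k}]}{18\sqrt{2c\ln n}}$$ we have $$R_{\mathsf{IgnoreLargeExp}}(\mathcal D,\boldsymbol\sigma)\ \ge\ \frac{c^2}{576}\cdot\mathbb E[\mathcal D_{n:n}].$$ -/

import Mathlib

open MeasureTheory ProbabilityTheory Set
open scoped NNReal ENNReal

noncomputable section

namespace NoisyBoxes

/-- A reward distribution `D` on `[0, ∞)` with a density `f` has monotone hazard rate if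
`(1 - F) / f` is non-increasing, where `1 - F x = D (Ioi x)`. The quotient is taken in `[0, ∞]`,
so it is `∞` where `f x = 0 < 1 - F x`, and it is `0` where `F x = 1`. -/
structure IsMHR (D : Measure ℝ) : Prop where
  isProbabilityMeasure : IsProbabilityMeasure D
  support_nonneg : D (Iio 0) = 0
  exists_density : ∃ f : ℝ → ℝ≥0∞, Measurable f ∧ D = volume.withDensity f ∧
    Antitone fun x => D (Ioi x) / f x

/-- `E[D_{k:k}]`, the expected maximum of `k` i.i.d. draws from `D`. -/
def expectedMax (D : Measure ℝ) (k : ℕ) : ℝ :=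
  ∫ x : Fin k → ℝ, ⨆ i, x i ∂(Measure.pi fun _ => D)

/-- The joint law of the rewards `x` and of the noise vector `ε`: all coordinates are independent,
`x i` has law `D`, and `ε i` is normal with mean `0` and standard deviation `σ i`
(the point mass at `0` when `σ i = 0`). The observations are `y = x + ε`. -/
def rewardNoiseLaw (D : Measure ℝ) {n : ℕ} (σ : Fin n → ℝ≥0) :
    Measure ((Fin n → ℝ) × (Fin n → ℝ)) :=
  (Measure.pi fun _ => D).prod (Measure.pi fun i => gaussianReal 0 (σ i ^ 2))

/-- A policy maps the noise levels `σ` and the observations `y` to a distribution over boxes. -/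
abbrev Policy (n : ℕ) : Type :=
  (Fin n → ℝ≥0) → (Fin n → ℝ) → ProbabilityMeasure (Fin n)

/-- `R_A(D, σ)`: the expected reward `x i` of the box `i` that the policy `A` picks, over the
rewards, the observations and the randomness of `A`. -/
def Policy.reward {n : ℕ} (A : Policy n) (D : Measure ℝ) (σ : Fin n → ℝ≥0) : ℝ :=
  ∫ p, (∫ i, p.1 i ∂(A σ (p.1 + p.2) : Measure (Fin n))) ∂(rewardNoiseLaw D σ)

open Classical in
/-- The boxes with the largest observation among the first `k` boxes. -/
def prefixArgmax {n : ℕ} (y : Fin n → ℝ) (k : ℕ) : Finset (Fin n) :=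
  {i | (i : ℕ) < k ∧ ∀ j : Fin n, (j : ℕ) < k → y j ≤ y i}

/-- `Naive` run on the first `k` boxes: the box with the largest observation among them.
Ties (which have probability zero if `D` has a density) go to the smallest index, and the default
value `0` is used only when `k = 0`. -/
def naiveOnPrefix {n : ℕ} [NeZero n] (y : Fin n → ℝ) (k : ℕ) : Fin n :=
  if h : (prefixArgmax y k).Nonempty then (prefixArgmax y k).min' h else 0

/-- The uniform distribution on `[0, 1]`. -/
def uniform01 : ProbabilityMeasure ℝ :=
  ⟨volume.restrict (Icc 0 1), ⟨by simp⟩⟩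

theorem measurable_naiveOnPrefix_rpow {n : ℕ} [NeZero n] (y : Fin n → ℝ) :
    Measurable fun α : ℝ => naiveOnPrefix y ⌊(n : ℝ) ^ α⌋₊ := by
  have h : Measurable fun α : ℝ => ⌊(n : ℝ) ^ α⌋₊ :=
    Nat.measurable_floor.comp (measurable_const.pow measurable_id)
  exact (measurable_from_top (f := naiveOnPrefix y)).comp h

/-- `IgnoreLargeExp`: draw `α` uniformly from `[0, 1]`, and pick the box with the largest
observation among the boxes `i` (counted from `1`) with `i ≤ n ^ α`. The boxes are assumed to be
listed in order of increasing noise. -/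
def ignoreLargeExp (n : ℕ) [NeZero n] : Policy n := fun _ y =>
  uniform01.map (measurable_naiveOnPrefix_rpow y).aemeasurable

/-- Small noise for MHR distributions, with `k` in the place of `n ^ c`: the noise levels are
ordered, and the `k`-th lowest one (counted from `1`) is at most
`E[D_{k:k}] / (18 √(2 c ln n))`. -/
def SmallNoiseMHR (D : Measure ℝ) (n : ℕ) (c : ℝ) (k : ℕ) : Set (Fin n → ℝ≥0) :=
  {σ | Monotone σ ∧ ∃ i : Fin n, (i : ℕ) + 1 = k ∧
    (σ i : ℝ) ≤ expectedMax D k / (18 * √(2 * c * Real.log n))}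

end NoisyBoxes

end

namespace NoisyBoxes

/-! Only exponents `α ∈ [7c/8, c]` are needed. For such `α` put `m = ⌊n ^ α⌋` and let `q` be the `1
/ m` upper quantile of `D`; every quantity is compared with `q`.

Monotone hazard rate makes the survival function `S` submultiplicative along multiples of `q`, so `S
(j q) ≤ m ^ (-j)` (`IsMHR.survival_nsmul_le`). Hence the expected maximum of at most `m ^ r` draws
is at most `(r + 3/2) q` (`IsMHR.expectedMax_le`). Since `k ≤ m ^ 2` and `n ≤ m ^ ⌈2/c⌉`, this gives
`E[D_{k:k}] ≤ 7q/2` and `c E[D_{n:n}] ≤ 9q/2`.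

Conversely, one of the first `m` rewards exceeds `q` with probability at least `1 - 1/e`. Choosing
by observation loses at most the range of the noise, whose mean is at most `2 s √(2 c ln n)` when
`s` bounds the noise levels. The hypothesis on `σ_k` makes this loss at most `7q/18`, so the prefix
yields at least `(0.63 - 7/18) q ≥ q/16 ≥ (c/72) E[D_{n:n}]` (`IsMHR.le_integral_pickedReward`).
Integrating over an interval of length `c/8` gives `c² / 576`. -/

/-! ### Survival functions under monotone hazard rate -/

theorem continuous_measureReal_Ioi (D : Measure ℝ) [IsProbabilityMeasure D]
    [NullSingletonClass D] : Continuous fun x => D.real (Ioi x) := by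
  have hc : Continuous (cdf D) := by
    rw [continuous_iff_continuousAt]
    intro x
    rw [(monotone_cdf D).continuousAt_iff_leftLim_eq_rightLim, StieltjesFunction.rightLim_eq]
    have h : (cdf D).measure {x} = 0 := by rw [measure_cdf]; exact measure_singleton x
    rw [StieltjesFunction.measure_singleton, ENNReal.ofReal_eq_zero] at h
    exact le_antisymm ((monotone_cdf D).leftLim_le le_rfl) (by linarith)
  have h : (fun x => D.real (Ioi x)) = fun x => 1 - cdf D x := by
    funext x
    rw [cdf_eq_real, ← compl_Iic, probReal_compl_eq_one_sub measurableSet_Iic]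
  rw [h]
  exact continuous_const.sub hc

theorem tendsto_measureReal_Ioi_atTop (D : Measure ℝ) [IsProbabilityMeasure D] :
    Filter.Tendsto (fun x => D.real (Ioi x)) Filter.atTop (nhds 0) := by
  have h : (fun x => D.real (Ioi x)) = fun x => 1 - cdf D x := by
    funext x
    rw [cdf_eq_real, ← compl_Iic, probReal_compl_eq_one_sub measurableSet_Iic]
  rw [h]
  simpa using (tendsto_cdf_atTop D).const_sub 1

/-- A backward Grönwall inequality with a constant rate. -/
theorem le_exp_mul_of_sub_le_integral {u : ℝ → ℝ} (hu : Continuous u) {γ a b : ℝ} (hγ : 0 < γ)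
    (hab : a ≤ b) (h : ∀ t ∈ Icc a b, γ * (u t - u b) ≤ ∫ s in t..b, u s) :
    u a ≤ Real.exp ((b - a) / γ) * u b := by
  -- The integrating factor makes `Φ` monotone. No sign of `u` is used, so the lemma applies to a
  -- survival function and to its negative.
  set Φ : ℝ → ℝ := fun t => Real.exp (t / γ) * ((∫ s in t..b, u s) + γ * u b) with hΦ
  have hd : ∀ t, HasDerivAt Φ (Real.exp (t / γ) * (1 / γ) * ((∫ s in t..b, u s) + γ * u b)
      + Real.exp (t / γ) * (-u t)) t := by
    intro t
    have h1 : HasDerivAt (fun t => Real.exp (t / γ)) (Real.exp (t / γ) * (1 / γ)) t :=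
      ((hasDerivAt_id t).div_const γ).exp
    have h2 : HasDerivAt (fun t => (∫ s in t..b, u s) + γ * u b) (-u t) t :=
      (intervalIntegral.integral_hasDerivAt_left (hu.intervalIntegrable _ _)
        (hu.stronglyMeasurableAtFilter _ _) hu.continuousAt).add_const _
    exact h1.mul h2
  have hm : MonotoneOn Φ (Icc a b) := by
    refine monotoneOn_of_deriv_nonneg (convex_Icc a b)
      (fun t _ => (hd t).continuousAt.continuousWithinAt)
      (fun t _ => (hd t).differentiableAt.differentiableWithinAt) fun t ht => ?_
    rw [interior_Icc] at ht
    rw [(hd t).deriv]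
    have h3 := h t ⟨ht.1.le, ht.2.le⟩
    have h4 : u t ≤ (1 / γ) * ((∫ s in t..b, u s) + γ * u b) := by
      rw [one_div, ← div_eq_inv_mul, le_div_iff₀ hγ]
      linarith
    have h5 := mul_le_mul_of_nonneg_left h4 (Real.exp_pos (t / γ)).le
    linarith
  have h6 := hm ⟨le_rfl, hab⟩ ⟨hab, le_rfl⟩ hab
  simp only [hΦ, intervalIntegral.integral_same, zero_add] at h6
  have h7 : Real.exp (a / γ) * (γ * u a) ≤ Real.exp (b / γ) * (γ * u b) :=
    (mul_le_mul_of_nonneg_left (by linarith [h a ⟨le_rfl, hab⟩]) (Real.exp_pos _).le).trans h6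
  have h8 : Real.exp (b / γ) = Real.exp (a / γ) * Real.exp ((b - a) / γ) := by
    rw [← Real.exp_add]; congr 1; ring
  rw [h8] at h7
  have h9 : 0 < Real.exp (a / γ) * γ := by positivity
  refine le_of_mul_le_mul_left ?_ h9
  linarith

/-- The survival function of an MHR distribution decays at least as fast on later intervals. -/
theorem IsMHR.survival_mul_le {D : Measure ℝ} (hD : IsMHR D) {a b q : ℝ} (hq : 0 ≤ q)
    (hab : a + q ≤ b) :
    D.real (Ioi a) * D.real (Ioi (b + q)) ≤ D.real (Ioi (a + q)) * D.real (Ioi b) := by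
  have := hD.isProbabilityMeasure
  obtain ⟨f, hf, hDf, hanti⟩ := hD.exists_density
  have : NullSingletonClass D := by
    rw [hDf]; exact nullSingletonClass_withDensity f
  have hcont := continuous_measureReal_Ioi D
  have hmono : ∀ {x y : ℝ}, x ≤ y → D.real (Ioi y) ≤ D.real (Ioi x) := fun h =>
    measureReal_mono (Ioi_subset_Ioi h)
  have hIoc : ∀ {x y : ℝ}, x ≤ y → D.real (Ioi x) - D.real (Ioi y) = D.real (Ioc x y) := by
    intro x y h
    rw [← Ioc_union_Ioi_eq_Ioi h, measureReal_union _ measurableSet_Ioi]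
    · ring
    · exact Set.disjoint_left.2 fun z hz hz' => not_lt.2 hz.2 hz'
  have hlint : ∀ {x y : ℝ}, D (Ioc x y) = ∫⁻ s in Ioc x y, f s := by
    intro x y
    conv_lhs => rw [hDf]
    rw [withDensity_apply f measurableSet_Ioc]
  have hint : ∀ {x y : ℝ}, x ≤ y →
      ∫⁻ s in Ioc x y, D (Ioi s) = ENNReal.ofReal (∫ s in x..y, D.real (Ioi s)) := by
    intro x y h
    rw [intervalIntegral.integral_of_le h, ofReal_integral_eq_lintegral_ofReal]
    · refine lintegral_congr fun s => ?_
      rw [measureReal_def, ENNReal.ofReal_toReal (measure_ne_top _ _)]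
    · exact (hcont.integrableOn_Icc).mono_set Ioc_subset_Icc_self
    · exact Filter.Eventually.of_forall fun s => measureReal_nonneg
  have hreal : ∀ {x y : ℝ}, D (Ioc x y) = ENNReal.ofReal (D.real (Ioc x y)) := by
    intro x y
    rw [measureReal_def, ENNReal.ofReal_toReal (measure_ne_top _ _)]
  have hint0 : ∀ {x y : ℝ}, x ≤ y → 0 ≤ ∫ s in x..y, D.real (Ioi s) := fun h =>
    intervalIntegral.integral_nonneg h fun s _ => measureReal_nonneg
  have hftop : ∀ᵐ s ∂volume, f s ≠ ∞ := by
    have h : ∫⁻ s, f s ≠ ∞ := by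
      rw [← setLIntegral_univ, ← withDensity_apply f MeasurableSet.univ, ← hDf]
      exact measure_ne_top _ _
    filter_upwards [ae_lt_top hf h] with s hs using hs.ne
  -- The ratio at `b` separates the two intervals: the ratio is at least `g` on `[a, a + q]` and at
  -- most `g` on `[b, b + q]`.
  set g := D (Ioi b) / f b with hg
  -- Here the density vanishes on `(a, a + q]`, so survival is constant there.
  by_cases hgtop : g = ∞
  · have hz : D (Ioc a (a + q)) = 0 := by
      rw [hlint]
      refine (lintegral_congr_ae ?_).trans lintegral_zero
      refine (ae_restrict_iff' measurableSet_Ioc).2 (Filter.Eventually.of_forall fun s hs => ?_)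
      have h1 : ∞ ≤ D (Ioi s) / f s := hgtop ▸ hanti (hs.2.trans hab)
      rw [top_le_iff, ENNReal.div_eq_top] at h1
      rcases h1 with h1 | h1
      · exact h1.2
      · exact absurd h1.1 (measure_ne_top _ _)
    have h2 := hIoc (le_add_of_nonneg_right hq : a ≤ a + q)
    rw [measureReal_def (s := Ioc a (a + q)), hz, ENNReal.toReal_zero] at h2
    rw [sub_eq_zero.1 h2]
    exact mul_le_mul_of_nonneg_left (hmono (by linarith)) measureReal_nonneg
  -- Here no mass lies beyond `b`: otherwise, by continuity, survival would stay positive on some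
  -- `(b, s)`, and a zero ratio would force `f = ∞` there.
  by_cases hg0 : g = 0
  · have hz : D (Ioi (b + q)) = 0 := by
      have h1 : D (Ioi b) = 0 := by
        by_contra hne
        obtain ⟨s, hs, hs'⟩ : ∃ s > b, D (Ioi s) ≠ 0 := by
          by_contra! hcon
          have h2 : ∀ s > b, D.real (Ioi s) = 0 := fun s hs => by
            rw [measureReal_def, hcon s hs, ENNReal.toReal_zero]
          have h3 : Filter.Tendsto (fun x => D.real (Ioi x)) (nhdsWithin b (Ioi b))
              (nhds (D.real (Ioi b))) := hcont.continuousAt.tendsto.mono_left nhdsWithin_le_nhds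
          have h4 : Filter.Tendsto (fun x => D.real (Ioi x)) (nhdsWithin b (Ioi b)) (nhds 0) :=
            tendsto_const_nhds.congr' (by
              filter_upwards [self_mem_nhdsWithin] with s hs using (h2 s hs).symm)
          have h5 := tendsto_nhds_unique h3 h4
          rw [measureReal_def, ENNReal.toReal_eq_zero_iff] at h5
          exact h5.elim hne (measure_ne_top _ _)
        have h6 : volume (Ioo b s) = 0 := by
          refine measure_mono_null (fun t ht => ?_) (ae_iff.1 hftop)
          have h7 : D (Ioi t) / f t ≤ g := hanti ht.1.le
          rw [hg0, nonpos_iff_eq_zero, ENNReal.div_eq_zero_iff] at h7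
          rcases h7 with h7 | h7
          · exact absurd (measure_mono_null (Ioi_subset_Ioi ht.2.le) h7) hs'
          · simpa using h7
        rw [Real.volume_Ioo, ENNReal.ofReal_eq_zero] at h6
        linarith
      exact measure_mono_null (Ioi_subset_Ioi (by linarith)) h1
    rw [measureReal_def (s := Ioi (b + q)), hz, ENNReal.toReal_zero, mul_zero]
    exact mul_nonneg measureReal_nonneg measureReal_nonneg
  set γ := g.toReal with hγdef
  have hγ : 0 < γ := ENNReal.toReal_pos hg0 hgtop
  have hgγ : g = ENNReal.ofReal γ := (ENNReal.ofReal_toReal hgtop).symm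
  have hleft : ∀ t ≤ a + q,
      γ * (D.real (Ioi t) - D.real (Ioi (a + q))) ≤ ∫ s in t..a + q, D.real (Ioi s) := by
    intro t ht
    rw [hIoc ht, ← ENNReal.ofReal_le_ofReal_iff (hint0 ht), ENNReal.ofReal_mul hγ.le, ← hreal,
      ← hgγ, ← hint ht, hlint, ← lintegral_const_mul g hf]
    refine setLIntegral_mono' measurableSet_Ioc fun s hs => ?_
    have h1 : g ≤ D (Ioi s) / f s := hanti (hs.2.trans hab)
    exact ENNReal.mul_le_of_le_div h1
  have hright : ∀ t ∈ Icc b (b + q), ∫ s in t..b + q, D.real (Ioi s) ≤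
      γ * (D.real (Ioi t) - D.real (Ioi (b + q))) := by
    intro t ht
    rw [hIoc ht.2, ← ENNReal.ofReal_le_ofReal_iff (mul_nonneg hγ.le measureReal_nonneg),
      ENNReal.ofReal_mul hγ.le, ← hreal, ← hgγ, ← hint ht.2, hlint, ← lintegral_const_mul g hf]
    refine setLIntegral_mono' measurableSet_Ioc fun s hs => ?_
    have h1 : D (Ioi s) / f s ≤ g := hanti (ht.1.trans hs.1.le)
    by_cases hfs : f s = ∞
    · rw [hfs, ENNReal.mul_top hg0]; exact le_top
    · by_cases hfs0 : f s = 0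
      · have h2 : D (Ioi s) = 0 := by
          by_contra hne
          rw [hfs0, ENNReal.div_zero hne] at h1
          exact hgtop (top_le_iff.1 h1)
        rw [h2]; exact zero_le
      · exact (ENNReal.div_le_iff hfs0 hfs).1 h1
  have h1 := le_exp_mul_of_sub_le_integral hcont hγ (le_add_of_nonneg_right hq : a ≤ a + q) fun t ht => hleft t ht.2
  -- Grönwall for the negated survival function gives decay by at least `exp (-q / γ)` on the later
  -- interval.
  have hneg : ∀ t ∈ Icc b (b + q), γ * (-D.real (Ioi t) - -D.real (Ioi (b + q))) ≤
      ∫ s in t..b + q, -D.real (Ioi s) := by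
    intro t ht
    rw [intervalIntegral.integral_neg]
    linarith [hright t ht]
  have h2 := le_exp_mul_of_sub_le_integral hcont.neg hγ (le_add_of_nonneg_right hq : b ≤ b + q) hneg
  have e1 : (a + q - a) / γ = q / γ := by ring
  have e2 : (b + q - b) / γ = q / γ := by ring
  rw [e1] at h1
  rw [e2] at h2
  calc D.real (Ioi a) * D.real (Ioi (b + q))
      ≤ (Real.exp (q / γ) * D.real (Ioi (a + q))) * D.real (Ioi (b + q)) :=
        mul_le_mul_of_nonneg_right h1 measureReal_nonneg
    _ = D.real (Ioi (a + q)) * (Real.exp (q / γ) * D.real (Ioi (b + q))) := by ring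
    _ ≤ _ := mul_le_mul_of_nonneg_left (by simpa using h2) measureReal_nonneg

theorem IsMHR.nullSingletonClass {D : Measure ℝ} (hD : IsMHR D) : NullSingletonClass D := by
  obtain ⟨f, -, hDf, -⟩ := hD.exists_density
  rw [hDf]
  exact nullSingletonClass_withDensity f

theorem IsMHR.survival_zero {D : Measure ℝ} (hD : IsMHR D) : D.real (Ioi 0) = 1 := by
  have := hD.isProbabilityMeasure
  have := hD.nullSingletonClass
  rw [← compl_Iic, probReal_compl_eq_one_sub measurableSet_Iic, measureReal_def,
    ← Iio_union_right, measure_union_null hD.support_nonneg (measure_singleton 0)]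
  simp

/-- Comparing `[0, q]`, where survival starts at `1`, with `[j q, (j + 1) q]` shows that each
further step of length `q` costs at least a factor `D.real (Ioi q)`. -/
theorem IsMHR.survival_nsmul_le {D : Measure ℝ} (hD : IsMHR D) {q : ℝ} (hq : 0 ≤ q) (j : ℕ) :
    D.real (Ioi (j * q)) ≤ D.real (Ioi q) ^ j := by
  have := hD.isProbabilityMeasure
  induction j with
  | zero => simp
  | succ j ih =>
    have hstep : D.real (Ioi ((j + 1 : ℕ) * q)) ≤ D.real (Ioi q) * D.real (Ioi (j * q)) := by
      rcases Nat.eq_zero_or_pos j with rfl | hj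
      · simp [hD.survival_zero]
      · have h1 : (1 : ℝ) ≤ j := by exact_mod_cast hj
        have h := hD.survival_mul_le (a := 0) (b := j * q) hq (by nlinarith)
        rw [hD.survival_zero, one_mul, zero_add] at h
        convert h using 3
        push_cast; ring
    calc _ ≤ _ := hstep
      _ ≤ D.real (Ioi q) * D.real (Ioi q) ^ j := mul_le_mul_of_nonneg_left ih measureReal_nonneg
      _ = _ := by ring

theorem IsMHR.exists_quantile {D : Measure ℝ} (hD : IsMHR D) {p : ℝ} (hp : 0 < p) (hp1 : p < 1) :
    ∃ q, 0 < q ∧ D.real (Ioi q) = p := by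
  have := hD.isProbabilityMeasure
  have := hD.nullSingletonClass
  obtain ⟨b, hb, hb0⟩ := (((tendsto_measureReal_Ioi_atTop D).eventually (gt_mem_nhds hp)).and
    (Filter.eventually_ge_atTop 0)).exists
  obtain ⟨q, hq, hqp⟩ := intermediate_value_Icc' hb0 (continuous_measureReal_Ioi D).continuousOn
    (show p ∈ Icc (D.real (Ioi b)) (D.real (Ioi 0)) from ⟨hb.le, hD.survival_zero ▸ hp1.le⟩)
  refine ⟨q, lt_of_le_of_ne hq.1 ?_, hqp⟩
  rintro rfl
  simp only [hD.survival_zero] at hqp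
  linarith

/-! ### Numerical bounds on the prefix size -/

/-- The threshold on `x` gives `α log x ≥ 7 / (2π) > 1.113`, and `e ^ 1.113 ≥ 1.113 e > 3`. -/
theorem three_le_floor_rpow {c α x : ℝ} (hc : 0 < c) (hx : Real.exp (4 / (c * Real.pi)) ≤ x)
    (hα : 7 / 8 * c ≤ α) : 3 ≤ ⌊x ^ α⌋₊ := by
  have hx0 : 0 < x := (Real.exp_pos _).trans_le hx
  have hpi := Real.pi_pos
  refine Nat.le_floor ?_
  have h1 : 4 / (c * Real.pi) ≤ Real.log x := (Real.le_log_iff_exp_le hx0).2 hx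
  have h2 : (1.113 : ℝ) ≤ Real.log x * α := by
    have h3 : 4 / (c * Real.pi) * (7 / 8 * c) ≤ Real.log x * α :=
      mul_le_mul h1 hα (by positivity) ((by positivity : (0:ℝ) ≤ 4 / (c * Real.pi)).trans h1)
    have h4 : 4 / (c * Real.pi) * (7 / 8 * c) = 3.5 / Real.pi := by field_simp; norm_num
    rw [h4] at h3
    refine le_trans ?_ h3
    rw [le_div_iff₀ hpi]
    nlinarith [Real.pi_lt_d4]
  rw [Real.rpow_def_of_pos hx0]
  have h5 : Real.exp 1 * Real.exp 0.113 ≤ Real.exp (Real.log x * α) := by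
    rw [← Real.exp_add]; exact Real.exp_le_exp.2 (by linarith)
  have h6 := Real.add_one_le_exp (0.113 : ℝ)
  have h7 := Real.exp_one_gt_d9
  push_cast
  nlinarith

/-- With `m = ⌊x ^ α⌋₊`, the chain is `(x ^ c) ^ 7 ≤ (x ^ α) ^ 8 ≤ (m + 1) ^ 8 ≤ (m ^ 2 - 1) ^ 7`,
the last step being `m + 1 ≤ (m - 1) ^ 7`. The `- 1` leaves room for rounding `x ^ c` up. -/
theorem rpow_le_floor_rpow_sq_sub_one {c α x : ℝ} (hx : 1 ≤ x) (hα : 7 / 8 * c ≤ α)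
    (hm : 3 ≤ ⌊x ^ α⌋₊) : x ^ c ≤ (⌊x ^ α⌋₊ : ℝ) ^ 2 - 1 := by
  have hx0 : 0 ≤ x := by linarith
  set m := ⌊x ^ α⌋₊
  have hm3 : (3 : ℝ) ≤ m := by exact_mod_cast hm
  have h1 : x ^ α ≤ m + 1 := (Nat.lt_floor_add_one _).le
  have h2 : (x ^ c) ^ 7 ≤ (x ^ α) ^ 8 := by
    rw [← Real.rpow_natCast, ← Real.rpow_natCast, ← Real.rpow_mul hx0, ← Real.rpow_mul hx0]
    exact Real.rpow_le_rpow_of_exponent_le hx (by push_cast; linarith)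
  have h3 : (x ^ α) ^ 8 ≤ ((m : ℝ) + 1) ^ 8 := pow_le_pow_left₀ (Real.rpow_nonneg hx0 _) h1 8
  have h4 : ((m : ℝ) + 1) ≤ ((m : ℝ) - 1) ^ 7 := by
    have h5 : (2 : ℝ) ^ 6 ≤ ((m : ℝ) - 1) ^ 6 := pow_le_pow_left₀ (by norm_num) (by linarith) 6
    nlinarith
  have h6 : ((m : ℝ) + 1) ^ 8 ≤ ((m : ℝ) ^ 2 - 1) ^ 7 := by
    have h7 : ((m : ℝ) ^ 2 - 1) ^ 7 = ((m : ℝ) - 1) ^ 7 * ((m : ℝ) + 1) ^ 7 := by ring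
    rw [h7, pow_succ' _ 7]
    exact mul_le_mul_of_nonneg_right h4 (by positivity)
  exact le_of_pow_le_pow_left₀ (by norm_num) (by nlinarith) (h2.trans (h3.trans h6))

theorem le_floor_rpow_pow_ceil {c α x : ℝ} (hc : 0 < c) (hx : 1 ≤ x) (hα : 7 / 8 * c ≤ α)
    (hm : 3 ≤ ⌊x ^ α⌋₊) : x ≤ (⌊x ^ α⌋₊ : ℝ) ^ ⌈2 / c⌉₊ := by
  have hx0 : 0 ≤ x := by linarith
  have h1 := rpow_le_floor_rpow_sq_sub_one hx hα hm
  set m := ⌊x ^ α⌋₊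
  have hm3 : (3 : ℝ) ≤ m := by exact_mod_cast hm
  calc x = (x ^ c) ^ (1 / c) := by
        rw [← Real.rpow_mul hx0, mul_one_div_cancel hc.ne', Real.rpow_one]
    _ ≤ ((m : ℝ) ^ 2) ^ (1 / c) :=
        Real.rpow_le_rpow (Real.rpow_nonneg hx0 _) (by linarith) (by positivity)
    _ = (m : ℝ) ^ (2 / c) := by
        rw [← Real.rpow_natCast, ← Real.rpow_mul (by positivity)]; congr 1; push_cast; ring
    _ ≤ (m : ℝ) ^ ((⌈2 / c⌉₊ : ℕ) : ℝ) :=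
        Real.rpow_le_rpow_of_exponent_le (by linarith) (Nat.le_ceil _)
    _ = _ := Real.rpow_natCast _ _

/-! ### The naive choice on a fixed prefix -/

/-- The choice depends on `y` only through the comparisons `y j ≤ y i`, which range over a finite
type. -/
theorem measurable_naiveOnPrefix {n : ℕ} [NeZero n] (m : ℕ) :
    Measurable fun y : Fin n → ℝ => naiveOnPrefix y m := by
  let F : (Fin n → Fin n → Prop) → Fin n := fun R =>
    open Classical in
    let s : Finset (Fin n) := {i | (i : ℕ) < m ∧ ∀ j : Fin n, (j : ℕ) < m → R j i}
    if h : s.Nonempty then s.min' h else 0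
  have hF : (fun y : Fin n → ℝ => naiveOnPrefix y m) = F ∘ fun y j i => y j ≤ y i := rfl
  rw [hF]
  refine (measurable_of_finite F).comp ?_
  refine measurable_pi_lambda _ fun j => measurable_pi_lambda _ fun i => ?_
  exact measurableSet_setOfPred.1 (measurableSet_le (measurable_pi_apply j) (measurable_pi_apply i))

theorem naiveOnPrefix_spec {n : ℕ} [NeZero n] (y : Fin n → ℝ) {m : ℕ} (hm : 0 < m) :
    (naiveOnPrefix y m : ℕ) < m ∧ ∀ j : Fin n, (j : ℕ) < m → y j ≤ y (naiveOnPrefix y m) := by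
  classical
  have hne : (prefixArgmax y m).Nonempty := by
    obtain ⟨i, hi, hi'⟩ := Finset.exists_max_image (Finset.univ.filter fun i : Fin n => (i : ℕ) < m)
      y ⟨0, by simpa using hm⟩
    exact ⟨i, by simpa [prefixArgmax] using ⟨by simpa using hi, by simpa using hi'⟩⟩
  have h := (prefixArgmax y m).min'_mem hne
  have h2 : naiveOnPrefix y m = (prefixArgmax y m).min' hne := by simp [naiveOnPrefix, hne]
  rw [← h2] at h
  simpa [prefixArgmax] using h

/-! ### Expected maxima in terms of a quantile -/

/-- The excess over `r q` is at most `q` times the number of levels `(r + j) q` lying below `x`.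
Their probabilities decay geometrically with ratio `1 / m ≤ 1/3`, whence the factor `3/2`. -/
theorem IsMHR.lintegral_sub_le {D : Measure ℝ} (hD : IsMHR D) {q : ℝ} (hq : 0 < q) {m : ℕ}
    (hm : 3 ≤ m) (hqm : D.real (Ioi q) = 1 / m) (r : ℕ) :
    ∫⁻ x, ENNReal.ofReal (x - r * q) ∂D ≤ ENNReal.ofReal (3 / 2 * q * (1 / m) ^ r) := by
  have := hD.isProbabilityMeasure
  have hm3 : (3 : ℝ) ≤ m := by exact_mod_cast hm
  have hp0 : (0 : ℝ) ≤ 1 / m := by positivity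
  have hp : (1 : ℝ) / m ≤ 1 / 3 := one_div_le_one_div_of_le (by norm_num) hm3
  have hp1 : (1 : ℝ) / m < 1 := by linarith
  have hpt : ∀ x : ℝ, ENNReal.ofReal (x - r * q) ≤
      ∑' j : ℕ, (Ioi (((r + j : ℕ) : ℝ) * q)).indicator (fun _ => ENNReal.ofReal q) x := by
    intro x
    set J := ⌈(x - r * q) / q⌉₊ with hJ
    calc ENNReal.ofReal (x - r * q) ≤ ENNReal.ofReal (J * q) := by
          refine ENNReal.ofReal_le_ofReal ?_
          rw [← div_le_iff₀ hq]; exact Nat.le_ceil _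
      _ = ∑ j ∈ Finset.range J, ENNReal.ofReal q := by
          rw [Finset.sum_const, Finset.card_range, nsmul_eq_mul,
            ENNReal.ofReal_mul (Nat.cast_nonneg _), ENNReal.ofReal_natCast]
      _ = ∑ j ∈ Finset.range J,
          (Ioi (((r + j : ℕ) : ℝ) * q)).indicator (fun _ => ENNReal.ofReal q) x := by
          refine Finset.sum_congr rfl fun j hj => ?_
          have h1 : (j : ℝ) < (x - r * q) / q := Nat.lt_ceil.1 (Finset.mem_range.1 hj)
          rw [lt_div_iff₀ hq] at h1
          rw [indicator_of_mem]
          rw [mem_Ioi]; push_cast; linarith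
      _ ≤ _ := ENNReal.sum_le_tsum _
  calc ∫⁻ x, ENNReal.ofReal (x - r * q) ∂D
      ≤ ∫⁻ x, ∑' j : ℕ, (Ioi (((r + j : ℕ) : ℝ) * q)).indicator
          (fun _ => ENNReal.ofReal q) x ∂D := lintegral_mono hpt
    _ = ∑' j : ℕ, ENNReal.ofReal q * D (Ioi (((r + j : ℕ) : ℝ) * q)) := by
        rw [lintegral_tsum fun j => (measurable_const.indicator measurableSet_Ioi).aemeasurable]
        exact tsum_congr fun j => lintegral_indicator_const measurableSet_Ioi _
    _ ≤ ∑' j : ℕ, ENNReal.ofReal (q * (1 / m) ^ r * (1 / m) ^ j) := by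
        refine ENNReal.tsum_le_tsum fun j => ?_
        have h1 := hD.survival_nsmul_le hq.le (r + j)
        rw [hqm, pow_add] at h1
        rw [mul_assoc, ENNReal.ofReal_mul hq.le]
        gcongr
        rw [← ENNReal.ofReal_toReal (measure_ne_top D _)]
        exact ENNReal.ofReal_le_ofReal h1
    _ = ENNReal.ofReal (q * (1 / m) ^ r * (1 - 1 / (m : ℝ))⁻¹) := by
        rw [← ENNReal.ofReal_tsum_of_nonneg (fun j => by positivity)
          ((summable_geometric_of_lt_one hp0 hp1).mul_left _), tsum_mul_left,
          tsum_geometric_of_lt_one hp0 hp1]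
    _ ≤ _ := by
        refine ENNReal.ofReal_le_ofReal ?_
        have h1 : (1 - 1 / (m : ℝ))⁻¹ ≤ 3 / 2 := by
          rw [inv_le_comm₀ (by linarith) (by norm_num)]; linarith
        have h2 : (0 : ℝ) ≤ q * (1 / m) ^ r := by positivity
        nlinarith

theorem IsMHR.ae_nonneg {D : Measure ℝ} (hD : IsMHR D) : ∀ᵐ x ∂D, 0 ≤ x := by
  rw [ae_iff]
  simpa [Iio_def] using hD.support_nonneg

theorem IsMHR.integrable_id {D : Measure ℝ} (hD : IsMHR D) : Integrable (fun x : ℝ => x) D := by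
  have := hD.isProbabilityMeasure
  obtain ⟨q, hq, hqm⟩ := hD.exists_quantile (p := 1 / (3 : ℕ)) (by norm_num) (by norm_num)
  refine ⟨measurable_id.aestronglyMeasurable, ?_⟩
  rw [hasFiniteIntegral_iff_ofReal hD.ae_nonneg]
  have h := hD.lintegral_sub_le hq le_rfl hqm 0
  simp only [CharP.cast_eq_zero, zero_mul, sub_zero] at h
  exact h.trans_lt ENNReal.ofReal_lt_top

theorem IsMHR.integrable_posPart_sub {D : Measure ℝ} (hD : IsMHR D) (a : ℝ) :
    Integrable (fun x => max (x - a) 0) D := by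
  have := hD.isProbabilityMeasure
  exact (hD.integrable_id.sub (integrable_const a)).pos_part

/-- The maximum is at most `r q` plus the sum of all excesses over `r q`; the `N ≤ m ^ r` terms
cancel the factor `m ^ (-r)` in the mean excess. -/
theorem IsMHR.expectedMax_le {D : Measure ℝ} (hD : IsMHR D) {q : ℝ} (hq : 0 < q) {m : ℕ}
    (hm : 3 ≤ m) (hqm : D.real (Ioi q) = 1 / m) {N r : ℕ} (hN : N ≤ m ^ r) :
    expectedMax D N ≤ (r + 3 / 2) * q := by
  have := hD.isProbabilityMeasure
  have hm3 : (3 : ℝ) ≤ m := by exact_mod_cast hm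
  have hmp := measurePreserving_eval (fun _ : Fin N => D)
  have hint : ∀ i : Fin N, Integrable (fun x : Fin N → ℝ => max (x i - r * q) 0)
      (Measure.pi fun _ => D) := fun i =>
    (hmp i).integrable_comp_of_integrable (hD.integrable_posPart_sub (r * q))
  have hval : ∫ x, max (x - r * q) 0 ∂D ≤ 3 / 2 * q * (1 / m) ^ r := by
    rw [integral_eq_lintegral_of_nonneg_ae (f := fun x => max (x - r * q) 0) (Filter.Eventually.of_forall fun x => le_max_right _ _)
      (hD.integrable_posPart_sub (r * q)).aestronglyMeasurable]
    refine ENNReal.toReal_le_of_le_ofReal (by positivity) ?_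
    refine le_trans (lintegral_mono fun x => ?_) (hD.lintegral_sub_le hq hm hqm r)
    rw [ENNReal.ofReal_max, ENNReal.ofReal_zero, max_eq_left zero_le]
  have hvi : ∀ i : Fin N, ∫ x : Fin N → ℝ, max (x i - r * q) 0 ∂(Measure.pi fun _ => D)
      = ∫ x, max (x - r * q) 0 ∂D := fun i => by
    rw [← integral_map (f := fun x => max (x - r * q) 0) (hmp i).measurable.aemeasurable
      (by fun_prop), (hmp i).map_eq]
  have hae : 0 ≤ᵐ[Measure.pi fun _ : Fin N => D] fun x => ⨆ i, x i := by
    have h : ∀ᵐ x ∂(Measure.pi fun _ : Fin N => D), ∀ i, 0 ≤ x i :=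
      ae_all_iff.2 fun i => (hmp i).quasiMeasurePreserving.ae hD.ae_nonneg
    filter_upwards [h] with x hx using Real.iSup_nonneg hx
  calc expectedMax D N
      ≤ ∫ x : Fin N → ℝ, (r * q + ∑ i, max (x i - r * q) 0) ∂(Measure.pi fun _ => D) := by
        refine integral_mono_of_nonneg hae
          ((integrable_const _).add (integrable_finsetSum _ fun i _ => hint i))
          (Filter.Eventually.of_forall fun x => ?_)
        refine Real.iSup_le (fun i => ?_) (by positivity)
        have h1 : max (x i - r * q) 0 ≤ ∑ i, max (x i - r * q) 0 :=
          Finset.single_le_sum (f := fun i => max (x i - r * q) 0)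
            (fun j _ => le_max_right _ _) (Finset.mem_univ i)
        linarith [le_max_left (x i - r * q) 0]
    _ = r * q + N * ∫ x, max (x - r * q) 0 ∂D := by
        rw [integral_add (integrable_const _) (integrable_finsetSum _ fun i _ => hint i),
          integral_finsetSum _ fun i _ => hint i]
        simp [hvi]
    _ ≤ r * q + m ^ r * (3 / 2 * q * (1 / m) ^ r) := by
        gcongr
        exact_mod_cast hN
    _ = (r + 3 / 2) * q := by
        rw [one_div, inv_pow]
        field_simp

/-- Some of the first `m` of `n` draws exceeds the `1 / m` upper quantile with probability
at least `1 - 1 / e`. -/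
theorem IsMHR.le_measureReal_exists_lt {D : Measure ℝ} (hD : IsMHR D) {q : ℝ} {m n : ℕ}
    (hm : 0 < m) (hmn : m ≤ n) (hqm : D.real (Ioi q) = 1 / m) :
    (0.63 : ℝ) ≤ (Measure.pi fun _ : Fin n => D).real
      {x | ∃ j : Fin n, (j : ℕ) < m ∧ q < x j} := by
  have := hD.isProbabilityMeasure
  -- The complement is a box, so independence gives it the probability `(1 - 1/m) ^ m ≤ 1/e`.
  have hset : {x : Fin n → ℝ | ∃ j : Fin n, (j : ℕ) < m ∧ q < x j} =
      (univ.pi fun j : Fin n => if (j : ℕ) < m then Iic q else univ)ᶜ := by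
    ext x
    simp only [mem_ofPred_eq, mem_compl_iff, mem_univ_pi, not_forall]
    refine exists_congr fun j => ?_
    split_ifs with h <;> simp [h]
  have hmeas : MeasurableSet (univ.pi fun j : Fin n => if (j : ℕ) < m then Iic q else univ) :=
    MeasurableSet.univ_pi fun j => by split_ifs; exacts [measurableSet_Iic, MeasurableSet.univ]
  have hIic : D.real (Iic q) = 1 - 1 / m := by
    rw [← hqm, ← compl_Ioi, probReal_compl_eq_one_sub measurableSet_Ioi]
  have hcard : (Finset.univ.filter fun j : Fin n => (j : ℕ) < m).card = m := by
    rw [Fin.card_filter_val_lt, min_eq_right hmn]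
  rw [hset, probReal_compl_eq_one_sub hmeas, measureReal_def, Measure.pi_pi, ENNReal.toReal_prod]
  have hprod : ∏ j : Fin n, (D (if (j : ℕ) < m then Iic q else univ)).toReal
      = (1 - 1 / (m : ℝ)) ^ m := by
    rw [← hIic]
    have : ∀ j : Fin n, (D (if (j : ℕ) < m then Iic q else univ)).toReal
        = if (j : ℕ) < m then D.real (Iic q) else 1 := fun j => by
      split_ifs <;> simp [measureReal_def]
    rw [Finset.prod_congr rfl fun j _ => this j, Finset.prod_ite, Finset.prod_const,
      Finset.prod_const_one, mul_one, hcard]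
  rw [hprod]
  have h1 : (1 - 1 / (m : ℝ)) ^ m ≤ Real.exp (-1) :=
    Real.one_sub_div_pow_le_exp_neg (by exact_mod_cast hm)
  have h2 := Real.exp_neg_one_lt_d9
  linarith

/-! ### The joint law and the range of the noise -/

instance {D : Measure ℝ} [IsProbabilityMeasure D] {n : ℕ} (σ : Fin n → ℝ≥0) :
    IsProbabilityMeasure (rewardNoiseLaw D σ) := by
  unfold rewardNoiseLaw; infer_instance

theorem measurePreserving_reward (D : Measure ℝ) [IsProbabilityMeasure D] {n : ℕ}
    (σ : Fin n → ℝ≥0) (i : Fin n) :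
    MeasurePreserving (fun p : (Fin n → ℝ) × (Fin n → ℝ) => p.1 i) (rewardNoiseLaw D σ) D :=
  (measurePreserving_eval (fun _ : Fin n => D) i).comp measurePreserving_fst

theorem measurePreserving_noise (D : Measure ℝ) [IsProbabilityMeasure D] {n : ℕ}
    (σ : Fin n → ℝ≥0) (i : Fin n) :
    MeasurePreserving (fun p : (Fin n → ℝ) × (Fin n → ℝ) => p.2 i) (rewardNoiseLaw D σ)
      (gaussianReal 0 (σ i ^ 2)) :=
  (measurePreserving_eval (fun i : Fin n => gaussianReal 0 (σ i ^ 2)) i).comp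
    measurePreserving_snd

theorem integrable_exp_noise (D : Measure ℝ) [IsProbabilityMeasure D] {n : ℕ}
    (σ : Fin n → ℝ≥0) (i : Fin n) (t : ℝ) :
    Integrable (fun p => Real.exp (t * p.2 i)) (rewardNoiseLaw D σ) :=
  (measurePreserving_noise D σ i).integrable_comp_of_integrable
    (g := fun x => Real.exp (t * x)) (integrable_exp_mul_gaussianReal t)

theorem integral_exp_noise (D : Measure ℝ) [IsProbabilityMeasure D] {n : ℕ}
    (σ : Fin n → ℝ≥0) (i : Fin n) (t : ℝ) :
    ∫ p, Real.exp (t * p.2 i) ∂(rewardNoiseLaw D σ) = Real.exp ((σ i : ℝ) ^ 2 * t ^ 2 / 2) := by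
  have h := mgf_gaussianReal (measurePreserving_noise D σ i).map_eq t
  rw [mgf] at h
  rw [h]
  congr 1
  push_cast
  ring

/-- A convex upper bound for `max ε + max (-ε)`, the maxima being over the first `m` boxes. -/
noncomputable def softNoiseRange {n : ℕ} (m : ℕ) (t a : ℝ) (ε : Fin n → ℝ) : ℝ :=
  t⁻¹ * (2 * (a - 1) + Real.exp (-a) *
    ∑ l ∈ Finset.univ.filter fun l : Fin n => (l : ℕ) < m, (Real.exp (t * ε l) + Real.exp (-t * ε l)))

/-- The tangent bound `x ≤ a - 1 + exp (x - a)` is applied to `t ε i` and to `-t ε j`; each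
exponential is one term of the sum. -/
theorem sub_le_softNoiseRange {n m : ℕ} {t : ℝ} (ht : 0 < t) (a : ℝ) (ε : Fin n → ℝ)
    {i j : Fin n} (hi : (i : ℕ) < m) (hj : (j : ℕ) < m) :
    ε i - ε j ≤ softNoiseRange m t a ε := by
  have key : ∀ x : ℝ, x ≤ a - 1 + Real.exp (-a) * Real.exp x := fun x => by
    rw [← Real.exp_add]; linarith [Real.add_one_le_exp (-a + x)]
  have h1 : Real.exp (t * ε i) ≤ ∑ l ∈ Finset.univ.filter fun l : Fin n => (l : ℕ) < m, Real.exp (t * ε l) :=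
    Finset.single_le_sum (f := fun l => Real.exp (t * ε l)) (fun _ _ => (Real.exp_pos _).le)
      (by simpa using hi)
  have h2 : Real.exp (-t * ε j) ≤ ∑ l ∈ Finset.univ.filter fun l : Fin n => (l : ℕ) < m, Real.exp (-t * ε l) :=
    Finset.single_le_sum (f := fun l => Real.exp (-t * ε l)) (fun _ _ => (Real.exp_pos _).le)
      (by simpa using hj)
  rw [softNoiseRange, ← div_eq_inv_mul, le_div_iff₀ ht, Finset.sum_add_distrib]
  have h3 := mul_le_mul_of_nonneg_left (add_le_add h1 h2) (Real.exp_pos (-a)).le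
  linarith [key (t * ε i), key (-t * ε j)]

theorem integrable_softNoiseRange (D : Measure ℝ) [IsProbabilityMeasure D] {n : ℕ}
    (σ : Fin n → ℝ≥0) (m : ℕ) (t a : ℝ) :
    Integrable (fun p => softNoiseRange m t a p.2) (rewardNoiseLaw D σ) :=
  ((integrable_const _).add ((integrable_finsetSum _ fun l _ =>
    (integrable_exp_noise D σ l t).add (integrable_exp_noise D σ l (-t))).const_mul _)).const_mul _

/-- With `t = √(2L) / s`, each exponential moment is at most `exp L`, as is `m`. So `a = 2L` makes
the exponential part at most `2`, which cancels the `-2` and leaves `4L / t`. Bounds `s` and `L` in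
place of exact values also cover zero noise levels. -/
theorem integral_softNoiseRange_le (D : Measure ℝ) [IsProbabilityMeasure D] {n : ℕ}
    (σ : Fin n → ℝ≥0) {m : ℕ} (hm : 0 < m) (hmn : m ≤ n) {s L : ℝ} (hs : 0 < s) (hL : 0 < L)
    (hmL : Real.log m ≤ L) (hσ : ∀ l : Fin n, (l : ℕ) < m → (σ l : ℝ) ≤ s) :
    ∫ p, softNoiseRange m (√(2 * L) / s) (2 * L) p.2 ∂(rewardNoiseLaw D σ) ≤
      2 * s * √(2 * L) := by
  have hw : 0 < √(2 * L) := Real.sqrt_pos.2 (by linarith)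
  have hw2 : √(2 * L) ^ 2 = 2 * L := Real.sq_sqrt (by linarith)
  set t := √(2 * L) / s with ht
  have ht2 : s ^ 2 * t ^ 2 = 2 * L := by
    rw [ht, div_pow, hw2]; field_simp
  have htpos : 0 < t := div_pos hw hs
  have hsum : ∀ l : Fin n, Integrable (fun p => Real.exp (t * p.2 l) + Real.exp (-t * p.2 l))
      (rewardNoiseLaw D σ) := fun l =>
    (integrable_exp_noise D σ l t).add (integrable_exp_noise D σ l (-t))
  have hval : ∀ l ∈ (Finset.univ.filter fun l : Fin n => (l : ℕ) < m),
      ∫ p, (Real.exp (t * p.2 l) + Real.exp (-t * p.2 l)) ∂(rewardNoiseLaw D σ) ≤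
        2 * Real.exp L := by
    intro l hl
    have h1 : (σ l : ℝ) ^ 2 * t ^ 2 / 2 ≤ L := by
      have h2 : (σ l : ℝ) ^ 2 ≤ s ^ 2 :=
        pow_le_pow_left₀ (σ l).coe_nonneg (hσ l (by simpa using hl)) 2
      nlinarith [mul_le_mul_of_nonneg_right h2 (sq_nonneg t)]
    rw [integral_add (integrable_exp_noise D σ l t) (integrable_exp_noise D σ l (-t)),
      integral_exp_noise, integral_exp_noise, neg_sq]
    linarith [Real.exp_le_exp.2 h1]
  have hcard : (Finset.univ.filter fun j : Fin n => (j : ℕ) < m).card = m := by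
    rw [Fin.card_filter_val_lt, min_eq_right hmn]
  have hme : (m : ℝ) ≤ Real.exp L := (Real.log_le_iff_le_exp (by exact_mod_cast hm)).1 hmL
  have htot := Finset.sum_le_card_nsmul _ _ _ hval
  rw [hcard, nsmul_eq_mul] at htot
  simp only [softNoiseRange]
  rw [integral_const_mul, integral_add (integrable_const _)
    ((integrable_finsetSum _ fun l _ => hsum l).const_mul _), integral_const_mul (Real.exp _),
    integral_finsetSum _ fun l _ => hsum l]
  have h3 : Real.exp (-(2 * L)) * (m * (2 * Real.exp L)) ≤ 2 := by
    have h4 : Real.exp (-(2 * L)) * (Real.exp L * (2 * Real.exp L)) = 2 := by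
      rw [show Real.exp (-(2 * L)) * (Real.exp L * (2 * Real.exp L)) =
        2 * (Real.exp (-(2 * L)) * Real.exp L * Real.exp L) by ring, ← Real.exp_add,
        ← Real.exp_add]
      ring_nf
      simp
    refine le_trans ?_ h4.le
    gcongr
  have h5 := mul_le_mul_of_nonneg_left htot (Real.exp_pos (-(2 * L))).le
  calc _ ≤ t⁻¹ * (2 * (2 * L)) := by
        refine mul_le_mul_of_nonneg_left ?_ (inv_pos.2 htpos).le
        simp only [integral_const, probReal_univ, one_smul]
        linarith
    _ = _ := by
        rw [ht]
        field_simp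
        linarith

/-! ### Reward of the prefix choice -/

theorem measurable_pickedReward {n : ℕ} [NeZero n] :
    Measurable fun z : ((Fin n → ℝ) × (Fin n → ℝ)) × ℕ =>
      z.1.1 (naiveOnPrefix (z.1.1 + z.1.2) z.2) := by
  refine measurable_from_prod_countable_left fun m => ?_
  have h1 : Measurable fun z : (Fin n → ℝ) × Fin n => z.1 z.2 :=
    measurable_from_prod_countable_left fun i => measurable_pi_apply i
  exact h1.comp (measurable_fst.prodMk
    ((measurable_naiveOnPrefix m).comp (measurable_fst.add measurable_snd)))

theorem IsMHR.integrable_sum_abs_reward {D : Measure ℝ} (hD : IsMHR D) {n : ℕ}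
    (σ : Fin n → ℝ≥0) : Integrable (fun p => ∑ i, |p.1 i|) (rewardNoiseLaw D σ) := by
  have := hD.isProbabilityMeasure
  exact integrable_finsetSum _ fun i _ =>
    ((measurePreserving_reward D σ i).integrable_comp_of_integrable hD.integrable_id).abs

theorem IsMHR.ae_reward_nonneg {D : Measure ℝ} (hD : IsMHR D) {n : ℕ} (σ : Fin n → ℝ≥0) :
    ∀ᵐ p ∂(rewardNoiseLaw D σ), ∀ i, 0 ≤ p.1 i := by
  have := hD.isProbabilityMeasure
  exact ae_all_iff.2 fun i =>
    (measurePreserving_reward D σ i).quasiMeasurePreserving.ae hD.ae_nonneg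

theorem IsMHR.integrable_pickedReward {D : Measure ℝ} (hD : IsMHR D) {n : ℕ} [NeZero n]
    (σ : Fin n → ℝ≥0) (m : ℕ) :
    Integrable (fun p => p.1 (naiveOnPrefix (p.1 + p.2) m)) (rewardNoiseLaw D σ) := by
  refine (hD.integrable_sum_abs_reward σ).mono'
    (measurable_pickedReward.comp measurable_prodMk_right).aestronglyMeasurable
    (Filter.Eventually.of_forall fun p => ?_)
  exact Finset.single_le_sum (f := fun i => |p.1 i|) (fun _ _ => abs_nonneg _) (Finset.mem_univ _)

/-- The expected reward of `Naive` on the first `m` boxes, with the `1 / m` upper quantile `q` of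
the reward distribution and a bound `s` on the noise levels of these boxes. -/
theorem IsMHR.le_integral_pickedReward {D : Measure ℝ} (hD : IsMHR D) {n : ℕ} [NeZero n]
    (σ : Fin n → ℝ≥0) {m : ℕ} (hm : 0 < m) (hmn : m ≤ n) {q s L : ℝ} (hq : 0 < q)
    (hqm : D.real (Ioi q) = 1 / m) (hs : 0 < s) (hL : 0 < L) (hmL : Real.log m ≤ L)
    (hσ : ∀ l : Fin n, (l : ℕ) < m → (σ l : ℝ) ≤ s) :
    0.63 * q - 2 * s * √(2 * L) ≤
      ∫ p, p.1 (naiveOnPrefix (p.1 + p.2) m) ∂(rewardNoiseLaw D σ) := by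
  have := hD.isProbabilityMeasure
  set A : Set (Fin n → ℝ) := {x | ∃ j : Fin n, (j : ℕ) < m ∧ q < x j} with hA
  have hAm : MeasurableSet A := by
    have h : A = ⋃ j : Fin n, {x | (j : ℕ) < m ∧ q < x j} := by ext x; simp [hA]
    rw [h]
    exact MeasurableSet.iUnion fun j => (MeasurableSet.const _).inter
      (measurableSet_lt measurable_const (measurable_pi_apply j))
  have hBm : MeasurableSet (Prod.fst ⁻¹' A : Set ((Fin n → ℝ) × (Fin n → ℝ))) :=
    measurable_fst hAm
  set noise : (Fin n → ℝ) × (Fin n → ℝ) → ℝ :=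
    fun p => softNoiseRange m (√(2 * L) / s) (2 * L) p.2 with hnoise
  have hni : Integrable noise (rewardNoiseLaw D σ) := integrable_softNoiseRange D σ m _ _
  have hii : Integrable ((Prod.fst ⁻¹' A : Set ((Fin n → ℝ) × (Fin n → ℝ))).indicator
      fun _ => q) (rewardNoiseLaw D σ) := (integrable_const q).indicator hBm
  have ht : 0 < √(2 * L) / s := div_pos (Real.sqrt_pos.2 (by linarith)) hs
  have hB : (rewardNoiseLaw D σ).real (Prod.fst ⁻¹' A) = (Measure.pi fun _ : Fin n => D).real A :=
    measurePreserving_fst.measureReal_preimage hAm.nullMeasurableSet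
  have hprob := hD.le_measureReal_exists_lt hm hmn hqm
  have hnb := integral_softNoiseRange_le D σ hm hmn hs hL hmL hσ
  calc 0.63 * q - 2 * s * √(2 * L)
      ≤ (∫ p, (Prod.fst ⁻¹' A : Set ((Fin n → ℝ) × (Fin n → ℝ))).indicator (fun _ => q) p
          ∂(rewardNoiseLaw D σ)) - ∫ p, noise p ∂(rewardNoiseLaw D σ) := by
        rw [integral_indicator_const _ hBm, hB, smul_eq_mul]
        exact sub_le_sub (mul_le_mul_of_nonneg_right hprob hq.le) hnb
    _ = ∫ p, ((Prod.fst ⁻¹' A : Set ((Fin n → ℝ) × (Fin n → ℝ))).indicator (fun _ => q) p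
          - noise p) ∂(rewardNoiseLaw D σ) := (integral_sub hii hni).symm
    _ ≤ _ := by
        refine integral_mono_ae (hii.sub hni) (hD.integrable_pickedReward σ m) ?_
        filter_upwards [hD.ae_reward_nonneg σ] with p hp
        obtain ⟨h1, h2⟩ := naiveOnPrefix_spec (p.1 + p.2) hm
        set i := naiveOnPrefix (p.1 + p.2) m
        by_cases hpA : p ∈ (Prod.fst ⁻¹' A : Set ((Fin n → ℝ) × (Fin n → ℝ)))
        -- Optimality of `i` gives `x i ≥ x j - (ε i - ε j)`, with `x j > q`.
        · rw [indicator_of_mem hpA]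
          obtain ⟨j, hj, hqj⟩ := hpA
          have h3 := h2 j hj
          simp only [Pi.add_apply] at h3
          have h4 := sub_le_softNoiseRange ht (2 * L) p.2 h1 hj
          simp only [hnoise]
          linarith
        · rw [indicator_of_notMem hpA]
          -- Equal indices show that the noise bound is nonnegative, so a nonnegative reward
          -- suffices off the event.
          have h4 := sub_le_softNoiseRange ht (2 * L) p.2 h1 h1
          simp only [hnoise]
          linarith [hp i]

/-- Fubini, with the sum of all `|x i|` as dominating function, makes the reward an average over `α`
of fixed-prefix rewards. -/
theorem IsMHR.reward_ignoreLargeExp {D : Measure ℝ} (hD : IsMHR D) {n : ℕ} [NeZero n]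
    (σ : Fin n → ℝ≥0) :
    IntegrableOn (fun α : ℝ => ∫ p, p.1 (naiveOnPrefix (p.1 + p.2) ⌊(n : ℝ) ^ α⌋₊)
      ∂(rewardNoiseLaw D σ)) (Icc 0 1) ∧
    (ignoreLargeExp n).reward D σ = ∫ α in Icc (0 : ℝ) 1,
      ∫ p, p.1 (naiveOnPrefix (p.1 + p.2) ⌊(n : ℝ) ^ α⌋₊) ∂(rewardNoiseLaw D σ) := by
  have := hD.isProbabilityMeasure
  have hfl : Measurable fun α : ℝ => ⌊(n : ℝ) ^ α⌋₊ :=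
    Nat.measurable_floor.comp (measurable_const.pow measurable_id)
  have hint : Integrable (Function.uncurry fun (p : (Fin n → ℝ) × (Fin n → ℝ)) (α : ℝ) =>
      p.1 (naiveOnPrefix (p.1 + p.2) ⌊(n : ℝ) ^ α⌋₊))
      ((rewardNoiseLaw D σ).prod (volume.restrict (Icc (0 : ℝ) 1))) := by
    refine ((hD.integrable_sum_abs_reward σ).comp_fst _).mono'
      (measurable_pickedReward.comp (measurable_fst.prodMk
        (hfl.comp measurable_snd))).aestronglyMeasurable (Filter.Eventually.of_forall fun z => ?_)
    exact Finset.single_le_sum (f := fun i => |z.1.1 i|) (fun _ _ => abs_nonneg _)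
      (Finset.mem_univ _)
  refine ⟨hint.integral_prod_right, ?_⟩
  rw [← integral_integral_swap hint, Policy.reward]
  refine integral_congr_ae (Filter.Eventually.of_forall fun p => ?_)
  exact integral_map (measurable_naiveOnPrefix_rpow (p.1 + p.2)).aemeasurable
    (measurable_of_finite _).aestronglyMeasurable

end NoisyBoxes

/-! ### Assembling the bound -/

open NoisyBoxes in
theorem mainTheorem2 (c : ℝ) (hc₀ : 0 < c) (hc₁ : c ≤ 1)
    (D : MeasureTheory.Measure ℝ) (hD : NoisyBoxes.IsMHR D)
    (n : ℕ) [NeZero n] (hn : Real.exp (4 / (c * Real.pi)) ≤ (n : ℝ))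
    (k : ℕ) (hk : k = ⌊(n : ℝ) ^ c⌋₊ ∨ k = ⌈(n : ℝ) ^ c⌉₊)
    (σ : Fin n → NNReal) (hσ : σ ∈ NoisyBoxes.SmallNoiseMHR D n c k) :
    c ^ 2 / 576 * NoisyBoxes.expectedMax D n ≤
      NoisyBoxes.Policy.reward (NoisyBoxes.ignoreLargeExp n) D σ := by
  obtain ⟨hmono, i, hik, hσi⟩ := hσ
  have hn1 : (1 : ℝ) < n := (Real.one_lt_exp_iff.2 (by positivity)).trans_le hn
  have hn0 : (0 : ℝ) ≤ n := by linarith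
  have hL : 0 < c * Real.log n := mul_pos hc₀ (Real.log_pos hn1)
  obtain ⟨hint, heq⟩ := hD.reward_ignoreLargeExp (n := n) σ
  set J : ℝ → ℝ := fun α => ∫ p, p.1 (naiveOnPrefix (p.1 + p.2) ⌊(n : ℝ) ^ α⌋₊)
    ∂(rewardNoiseLaw D σ) with hJ
  have hJ0 : ∀ α, 0 ≤ J α := fun α => MeasureTheory.integral_nonneg_of_ae (by
    filter_upwards [hD.ae_reward_nonneg σ] with p hp using hp _)
  have hlow : ∀ α ∈ Set.Icc (7 / 8 * c) c, c / 72 * expectedMax D n ≤ J α := by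
    rintro α ⟨hα, hαc⟩
    have hm3 := three_le_floor_rpow hc₀ hn hα
    have hsq := rpow_le_floor_rpow_sq_sub_one hn1.le hα hm3
    have hceil := le_floor_rpow_pow_ceil hc₀ hn1.le hα hm3
    set m := ⌊(n : ℝ) ^ α⌋₊ with hm
    have hm3' : (3 : ℝ) ≤ m := by exact_mod_cast hm3
    have hmc : (m : ℝ) ≤ (n : ℝ) ^ c :=
      (Nat.floor_le (Real.rpow_nonneg hn0 _)).trans
        (Real.rpow_le_rpow_of_exponent_le hn1.le hαc)
    have hmk : m ≤ k := by
      rcases hk with rfl | rfl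
      · exact Nat.le_floor hmc
      · exact_mod_cast hmc.trans (Nat.le_ceil _)
    have hkm : k ≤ m ^ 2 := by
      have h : (k : ℝ) ≤ (n : ℝ) ^ c + 1 := by
        rcases hk with rfl | rfl
        · linarith [Nat.floor_le (Real.rpow_nonneg hn0 c)]
        · exact (Nat.ceil_lt_add_one (Real.rpow_nonneg hn0 c)).le
      have h2 : (k : ℝ) ≤ (m : ℝ) ^ 2 := by linarith
      exact_mod_cast h2
    -- The index `i` witnessing the small-noise condition forces `k ≤ n`.
    have hmn : m ≤ n := hmk.trans (hik ▸ i.isLt)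
    obtain ⟨q, hq, hqm⟩ := hD.exists_quantile (p := 1 / (m : ℝ)) (by positivity) (by
      rw [div_lt_one (by linarith)]; linarith)
    have hEk := hD.expectedMax_le hq hm3 hqm hkm
    have hEn := hD.expectedMax_le hq hm3 hqm (N := n) (r := ⌈2 / c⌉₊) (by exact_mod_cast hceil)
    have hw : 0 < √(2 * (c * Real.log n)) := Real.sqrt_pos.2 (by linarith)
    rw [mul_assoc 2 c] at hσi
    -- This is the hypothesis on `σ_k` with `E[D_{k:k}]` replaced by its bound `(2 + 3/2) q`; unlike
    -- the original bound, it is visibly positive.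
    set s := 7 / 2 * q / (18 * √(2 * (c * Real.log n))) with hs
    have hs0 : 0 < s := by positivity
    have hσs : ∀ l : Fin n, (l : ℕ) < m → (σ l : ℝ) ≤ s := by
      intro l hl
      have h1 : (σ l : ℝ) ≤ σ i := by
        exact_mod_cast hmono (Fin.le_def.2 (by omega))
      refine h1.trans (hσi.trans ?_)
      rw [hs]
      gcongr
      push_cast at hEk
      linarith
    have hmL : Real.log m ≤ c * Real.log n := by
      rw [← Real.log_rpow (by linarith)]
      exact Real.log_le_log (by linarith) hmc
    have hJm := hD.le_integral_pickedReward σ (by omega) hmn hq hqm hs0 hL hmL hσs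
    have hsw : s * √(2 * (c * Real.log n)) = 7 / 36 * q := by
      rw [hs]
      generalize √(2 * (c * Real.log n)) = w at hw
      field_simp
      norm_num
    have hr : c * (⌈2 / c⌉₊ + 3 / 2) ≤ 9 / 2 := by
      have h1 : (⌈2 / c⌉₊ : ℝ) < 2 / c + 1 := Nat.ceil_lt_add_one (by positivity)
      have h2 := mul_le_mul_of_nonneg_left h1.le hc₀.le
      have h3 : c * (2 / c + 1) = 2 + c := by field_simp
      linarith
    have h4 := mul_le_mul_of_nonneg_left hEn hc₀.le
    have h5 := mul_le_mul_of_nonneg_right hr hq.le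
    change _ ≤ J α at hJm
    -- The comparison is `(1/72) (9/2) q = q/16 ≤ (0.63 - 7/18) q`.
    linarith
  have hsub : Set.Icc (7 / 8 * c) c ⊆ Set.Icc (0 : ℝ) 1 :=
    Set.Icc_subset_Icc (by positivity) hc₁
  rw [heq]
  calc c ^ 2 / 576 * expectedMax D n
      = MeasureTheory.volume.real (Set.Icc (7 / 8 * c) c) • (c / 72 * expectedMax D n) := by
        rw [Real.volume_real_Icc_of_le (by linarith), smul_eq_mul]; ring
    _ ≤ ∫ α in Set.Icc (7 / 8 * c) c, J α :=
        MeasureTheory.setIntegral_ge_of_const_le measurableSet_Icc (by simp) hlow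
          (hint.mono_set hsub)
    _ ≤ ∫ α in Set.Icc (0 : ℝ) 1, J α :=
        MeasureTheory.setIntegral_mono_set hint (Filter.Eventually.of_forall hJ0)
          hsub.eventuallyLE
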